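/- Let $A\in\mathbb{R}^{n\times m}$, let $\Delta_k=\{p\in\mathbb{R}^k : p_i\ge 0,\ \sum_i p_i=1\}$ and let $\operatorname{int}\Delta_k=\{p\in\Delta_k : p_i>0 \text{ for all } i\}$. Call $(x,y)\in\Delta_n\times\Delta_m$ an optimal solution of the matrix game $\min_{y\in\Delta_m}\max_{x\in\Delta_n}x^\top Ay$ if $y$ attains $\min_{y\in\Delta_m}\max_{x\in\Delta_n}x^\top Ay$ and $x$ attains $\max_{x\in\Delta_n}\min_{y\in\Delta_m}x^\top Ay$; by the minimax theorem these are exactly the minimax equilibria. For a constant stepsize $\eta>0$, the Optimistic Multiplicative-Weights-Update (OMWU) dynamics with initial points $(x^0,y^0),(x^1,y^1)$ is, for $t\ge 1$, $$x_i^{t+1}=x_i^t\,\frac{e^{2\eta(Ay^t)_i-\eta(Ay^{t-1})_i}}{\sum_{j=1}^n x_j^t e^{2\eta(Ay^t)_j-\eta(Ay^{t-1})_j}}\quad(1\le i\le n),\qquad y_i^{t+1}=y_i^t\,\frac{e^{-2\eta(A^\top x^t)_i+\eta(A^\top x^{t-1})_i}}{\sum_{j=1}^m y_j^t e^{-2\eta(A^\top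 x^t)_j+\eta(A^\top x^{t-1})_j}}\quad(1\le i\le m).$$ Suppose that the game has a unique optimal solution $(x^*,y^*)$. Then there is $\eta_0>0$, depending only on $n,m,A$, such that for every constant stepsize $0<\eta<\eta_0$ the OMWU dynamics started at $(x^0,y^0)=(x^1,y^1)=(\tfrac1n\mathbf{1},\tfrac1m\mathbf{1})$ satisfies $$\lim_{t\to\infty}(x^t,y^t)=(x^*,y^*).$$ Moreover, for all starting points $(x^0,y^0),(x^1,y^1)\in\operatorname{int}\Delta_n\times\operatorname{int}\Delta_m$ there is $\eta_0>0$, depending only on $n,m,A$ and the starting points, such that the same limit holds for every constant stepsize $0<\eta<\eta_0$. -/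

import Mathlib

open Filter Topology Matrix

noncomputable section

namespace OMWU

/-- The worst-case payment `max_{x ∈ Δ_n} xᵀ A y` of the min player when she plays `y`.
The maximum is over a compact set, so the supremum is attained whenever `Δ_n` is nonempty. -/
def maxPayoff {n m : ℕ} (A : Matrix (Fin n) (Fin m) ℝ) (y : Fin m → ℝ) : ℝ :=
  ⨆ x : stdSimplex ℝ (Fin n), (x : Fin n → ℝ) ⬝ᵥ (A *ᵥ y)

/-- The guaranteed payoff `min_{y ∈ Δ_m} xᵀ A y` of the max player when he plays `x`. -/
def minPayoff {n m : ℕ} (A : Matrix (Fin n) (Fin m) ℝ) (x : Fin n → ℝ) : ℝ :=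
  ⨅ y : stdSimplex ℝ (Fin m), x ⬝ᵥ (A *ᵥ (y : Fin m → ℝ))

/-- `(x, y)` is an optimal solution of the matrix game `min_y max_x xᵀ A y`: both are
probability vectors, `y` attains `min_y max_x xᵀ A y` and `x` attains `max_x min_y xᵀ A y`. -/
structure IsOptimal {n m : ℕ} (A : Matrix (Fin n) (Fin m) ℝ)
    (x : Fin n → ℝ) (y : Fin m → ℝ) : Prop where
  left_mem : x ∈ stdSimplex ℝ (Fin n)
  right_mem : y ∈ stdSimplex ℝ (Fin m)
  minimax : ∀ y' ∈ stdSimplex ℝ (Fin m), maxPayoff A y ≤ maxPayoff A y'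
  maximin : ∀ x' ∈ stdSimplex ℝ (Fin n), minPayoff A x' ≤ minPayoff A x

/-- Multiplicative reweighting: `p_i exp(u_i) / ∑_j p_j exp(u_j)`. -/
def reweight {k : ℕ} (p u : Fin k → ℝ) : Fin k → ℝ :=
  fun i => p i * Real.exp (u i) / ∑ j, p j * Real.exp (u j)

/-- One OMWU step: from the current pair `(x^t, y^t)` and the previous pair
`(x^{t-1}, y^{t-1})` to the next pair `(x^{t+1}, y^{t+1})`. -/
def step {n m : ℕ} (A : Matrix (Fin n) (Fin m) ℝ) (η : ℝ)
    (cur prev : (Fin n → ℝ) × (Fin m → ℝ)) : (Fin n → ℝ) × (Fin m → ℝ) :=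
  (reweight cur.1 (fun i => 2 * η * (A *ᵥ cur.2) i - η * (A *ᵥ prev.2) i),
   reweight cur.2 (fun j => -2 * η * (Aᵀ *ᵥ cur.1) j + η * (Aᵀ *ᵥ prev.1) j))

/-- The OMWU iterates `t ↦ (x^t, y^t)` with constant stepsize `η`, started from
`(x^0, y^0) = z0` and `(x^1, y^1) = z1`. -/
def iterate {n m : ℕ} (A : Matrix (Fin n) (Fin m) ℝ) (η : ℝ)
    (z0 z1 : (Fin n → ℝ) × (Fin m → ℝ)) : ℕ → (Fin n → ℝ) × (Fin m → ℝ)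
  | 0 => z0
  | 1 => z1
  | t + 2 => step A η (iterate A η z0 z1 (t + 1)) (iterate A η z0 z1 t)

/-- The uniform vector `(1/k, …, 1/k)`. -/
def uniform (k : ℕ) : Fin k → ℝ := fun _ => 1 / (k : ℝ)

/-- The (relative) interior of the probability simplex `Δ_k`. -/
def simplexInterior (k : ℕ) : Set (Fin k → ℝ) :=
  {p | p ∈ stdSimplex ℝ (Fin k) ∧ ∀ i, 0 < p i}

end OMWU

end

/-
With a small stepsize, the cross entropy from any equilibrium to the secondary iterates of the
optimistic method, plus a multiple of the squared lag between primary and secondary iterates, is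
decreasing. Hence consecutive iterates merge, and every cluster point `z` is a fixed point of the
reweighting maps whose support contains the supports of all equilibria. Compare `z` with a strictly
complementary equilibrium `w`: any pure strategy outside the support of `z` earns strictly less
than the value against `w`, and those in the support earn exactly the value against `z`, so
`(1 - ε) • w + ε • z` is an equilibrium for small `ε > 0`. As the cross entropy is linear in its
first argument, it converges for `z` too, necessarily to its value at the cluster point; the
divergence from `z` therefore tends to zero and Pinsker's inequality gives convergence to `z`.
Finally `z` is an equilibrium, since the weight of a pure strategy beating the value in the limit
would grow and could not tend to zero.
-/

namespace OMWU

section Farkas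

variable {𝕜 V ι : Type*} [Field 𝕜] [LinearOrder 𝕜] [IsStrictOrderedRing 𝕜]
  [AddCommGroup V] [Module 𝕜 V]

theorem mem_hull_image_of_forall_nonneg (s : Finset ι) (a : ι → Module.Dual 𝕜 V)
    (b : Module.Dual 𝕜 V) (h : ∀ x, (∀ i ∈ s, 0 ≤ a i x) → 0 ≤ b x) :
    b ∈ PointedCone.hull 𝕜 (a '' s) := by
  classical
  induction s using Finset.induction_on generalizing a b with
  | empty =>
    have hb : b = 0 := LinearMap.ext fun x =>
      le_antisymm (by simpa using h (-x) (by simp)) (h x (by simp))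
    exact hb ▸ zero_mem _
  | insert k s _ ih =>
    by_cases hb : ∀ x, (∀ i ∈ s, 0 ≤ a i x) → 0 ≤ b x
    · exact Submodule.span_mono (Set.image_mono (by simp)) (ih a b hb)
    obtain ⟨w, hw, hbw, hkw⟩ : ∃ w, (∀ i ∈ s, 0 ≤ a i w) ∧ b w ≤ 0 ∧ a k w = -1 := by
      push Not at hb
      obtain ⟨w, hw, hbw⟩ := hb
      have hkw : a k w < 0 := by
        by_contra! hkw
        exact hbw.not_ge (h w (Finset.forall_mem_insert _ _ _ |>.2 ⟨hkw, hw⟩))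
      have hc : 0 < (-a k w)⁻¹ := inv_pos.2 (neg_pos.2 hkw)
      refine ⟨(-a k w)⁻¹ • w, fun i hi => ?_, ?_, ?_⟩
      · simpa using mul_nonneg hc.le (hw i hi)
      · simpa using (mul_neg_of_pos_of_neg hc hbw).le
      · simp [inv_neg, hkw.ne]
    -- Restricting the functionals to the hyperplane `a k = 0` along `w` eliminates `a k`.
    have hmem : b + b w • a k ∈ PointedCone.hull 𝕜 ((fun i => a i + a i w • a k) '' s) := by
      refine ih _ _ fun x hx => ?_
      have hproj : 0 ≤ b (x + a k x • w) := h _ <| Finset.forall_mem_insert _ _ _ |>.2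
        ⟨by simp [hkw], fun i hi => by simpa [mul_comm] using hx i hi⟩
      simpa [mul_comm] using hproj
    have hk_mem : a k ∈ PointedCone.hull 𝕜 (a '' ↑(insert k s)) :=
      PointedCone.subset_hull ⟨k, by simp, rfl⟩
    have hle : PointedCone.hull 𝕜 ((fun i => a i + a i w • a k) '' s) ≤
        PointedCone.hull 𝕜 (a '' ↑(insert k s)) := by
      refine Submodule.span_le.2 ?_
      rintro _ ⟨i, hi, rfl⟩
      exact add_mem (PointedCone.subset_hull ⟨i, Finset.mem_insert_of_mem hi, rfl⟩)
        (Submodule.smul_mem _ ⟨a i w, hw i hi⟩ hk_mem)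
    have hsum := add_mem (hle hmem) (Submodule.smul_mem _ ⟨-b w, neg_nonneg.2 hbw⟩ hk_mem)
    convert hsum using 1
    ext x
    simp [Nonneg.mk_smul]

end Farkas

section StrictComplementarity

variable {𝕜 ι κ : Type*} [Field 𝕜] [LinearOrder 𝕜] [IsStrictOrderedRing 𝕜]
  [Fintype ι] [Fintype κ]

theorem exists_pos_or_exists_mulVec_neg (M : Matrix ι κ 𝕜) (i : ι) :
    (∃ x, 0 ≤ x ∧ -Mᵀ *ᵥ x ≤ 0 ∧ 0 < x i) ∨ ∃ y, 0 ≤ y ∧ M *ᵥ y ≤ 0 ∧ (M *ᵥ y) i < 0 := by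
  classical
  refine or_iff_not_imp_left.2 fun hx => ?_
  push Not at hx
  let a : κ ⊕ ι → Module.Dual 𝕜 (ι → 𝕜) :=
    Sum.elim (fun j => LinearMap.proj j ∘ₗ M.vecMulLinear) LinearMap.proj
  have hmem : -LinearMap.proj i ∈ PointedCone.hull 𝕜 (Set.range a) := by
    rw [← Set.image_univ, ← Finset.coe_univ]
    refine mem_hull_image_of_forall_nonneg _ a _ fun x h => ?_
    have hx0 : 0 ≤ x := fun k => h (Sum.inr k) (Finset.mem_univ _)
    have hMx : -Mᵀ *ᵥ x ≤ 0 := fun j => by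
      simpa [a, neg_mulVec, mulVec_transpose] using h (Sum.inl j) (Finset.mem_univ _)
    simpa using hx x hx0 hMx
  obtain ⟨c, hc⟩ := Submodule.mem_span_range_iff_exists_fun _ |>.1 hmem
  replace hc : ∑ p, (c p : 𝕜) • a p = -LinearMap.proj i := hc
  have hrow : ∀ k, (M *ᵥ fun j => (c (Sum.inl j) : 𝕜)) k + c (Sum.inr k)
      = -(Pi.single k 1 : ι → 𝕜) i := fun k => by
    have := DFunLike.congr_fun hc (Pi.single k 1)
    simpa [a, Fintype.sum_sum_type, -Nonneg.coe_smul, mulVec, dotProduct, Pi.single_apply,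
      mul_comm] using this
  refine ⟨fun j => c (Sum.inl j), fun j => (c _).2, fun k => ?_, ?_⟩
  · have hslack : (0 : 𝕜) ≤ c (Sum.inr k) := (c _).2
    have hsingle : (0 : ι → 𝕜) ≤ Pi.single k 1 := Pi.single_nonneg.2 zero_le_one
    have hi : 0 ≤ (Pi.single k 1 : ι → 𝕜) i := hsingle i
    rw [Pi.zero_apply]
    linarith [hrow k]
  · have hslack : (0 : 𝕜) ≤ c (Sum.inr i) := (c _).2
    have hi := hrow i
    rw [Pi.single_eq_same] at hi
    linarith

theorem exists_mulVec_lt (M : Matrix ι κ 𝕜) :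
    ∃ x y, 0 ≤ x ∧ -Mᵀ *ᵥ x ≤ 0 ∧ 0 ≤ y ∧ M *ᵥ y ≤ 0 ∧ ∀ i, (M *ᵥ y) i < x i := by
  have hrow : ∀ i, ∃ x y, 0 ≤ x ∧ -Mᵀ *ᵥ x ≤ 0 ∧ 0 ≤ y ∧ M *ᵥ y ≤ 0 ∧ (M *ᵥ y) i < x i := by
    intro i
    obtain ⟨x, hx, hMx, hxi⟩ | ⟨y, hy, hMy, hyi⟩ := exists_pos_or_exists_mulVec_neg M i
    · exact ⟨x, 0, hx, hMx, le_rfl, by simp, by simpa using hxi⟩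
    · exact ⟨0, y, le_rfl, by simp, hy, hMy, hyi⟩
  choose x y hx hMx hy hMy hlt using hrow
  refine ⟨∑ i, x i, ∑ i, y i, Finset.sum_nonneg fun i _ => hx i, ?_,
    Finset.sum_nonneg fun i _ => hy i, ?_, fun i => ?_⟩
  · rw [mulVec_sum]
    exact Finset.sum_nonpos fun i _ => hMx i
  · rw [mulVec_sum]
    exact Finset.sum_nonpos fun i _ => hMy i
  · rw [mulVec_sum, Finset.sum_apply, Finset.sum_apply]
    exact Finset.sum_lt_sum (fun k _ => (hMy k i).trans (hx k i)) ⟨i, Finset.mem_univ i, hlt i⟩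

theorem exists_strictly_complementary (M : Matrix ι κ 𝕜) :
    ∃ x y, 0 ≤ x ∧ -Mᵀ *ᵥ x ≤ 0 ∧ 0 ≤ y ∧ M *ᵥ y ≤ 0 ∧
      (∀ i, (M *ᵥ y) i < x i) ∧ ∀ j, (-Mᵀ *ᵥ x) j < y j := by
  obtain ⟨x₁, y₁, hx₁, hMx₁, hy₁, hMy₁, hlt₁⟩ := exists_mulVec_lt M
  obtain ⟨y₂, x₂, hy₂, hMy₂, hx₂, hMx₂, hlt₂⟩ := exists_mulVec_lt (-Mᵀ)
  simp only [transpose_neg, transpose_transpose, neg_neg] at hMy₂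
  refine ⟨x₁ + x₂, y₁ + y₂, add_nonneg hx₁ hx₂, ?_, add_nonneg hy₁ hy₂, ?_, fun i => ?_,
    fun j => ?_⟩
  · rw [mulVec_add]
    exact add_nonpos hMx₁ hMx₂
  · rw [mulVec_add]
    exact add_nonpos hMy₁ hMy₂
  · rw [mulVec_add]
    exact add_lt_add_of_lt_of_le (hlt₁ i) ((hMy₂ i).trans (hx₂ i))
  · rw [mulVec_add]
    exact add_lt_add_of_le_of_lt ((hMx₁ j).trans (hy₁ j)) (hlt₂ j)

end StrictComplementarity

section Simplex

variable {ι κ : Type*} [Fintype κ] {A : Matrix ι κ ℝ} {v : ℝ} {ys : κ → ℝ}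

theorem nonempty_of_mem_stdSimplex {p : κ → ℝ} (hp : p ∈ stdSimplex ℝ κ) : Nonempty κ := by
  by_contra! hempty
  simpa using hp.2

theorem dotProduct_le_of_mem_stdSimplex {p f : κ → ℝ} {c : ℝ} (hp : p ∈ stdSimplex ℝ κ)
    (hf : ∀ j, f j ≤ c) : p ⬝ᵥ f ≤ c := by
  have h : p ⬝ᵥ f ≤ p ⬝ᵥ fun _ => c := dotProduct_le_dotProduct_of_nonneg_left hf hp.1
  rwa [dotProduct, dotProduct, ← Finset.sum_mul, hp.2, one_mul] at h

theorem dotProduct_eq_of_forall_ne_zero {p f : κ → ℝ} {c : ℝ} (hp : p ∈ stdSimplex ℝ κ)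
    (hf : ∀ j, p j ≠ 0 → f j = c) : p ⬝ᵥ f = c := by
  have h : p ⬝ᵥ f = ∑ j, p j * c := Finset.sum_congr rfl fun j _ => by
    obtain hj | hj := eq_or_ne (p j) 0
    · rw [hj, zero_mul, zero_mul]
    · rw [hf j hj]
  rw [h, ← Finset.sum_mul, hp.2, one_mul]

theorem inv_sum_smul_mem_stdSimplex {p : κ → ℝ} (hp : 0 ≤ p) (hsum : 0 < ∑ j, p j) :
    (∑ j, p j)⁻¹ • p ∈ stdSimplex ℝ κ :=
  ⟨fun j => mul_nonneg (inv_nonneg.2 hsum.le) (hp j), by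
    simp only [Pi.smul_apply, smul_eq_mul, ← Finset.mul_sum, inv_mul_cancel₀ hsum.ne']⟩

theorem sub_const_mulVec (A : Matrix ι κ ℝ) (v : ℝ) (q : κ → ℝ) (i : ι) :
    ((A - of fun _ _ => v) *ᵥ q) i = (A *ᵥ q) i - v * ∑ j, q j := by
  simp [mulVec, dotProduct, Finset.mul_sum, sub_mul]

theorem exists_mem_stdSimplex_mulVec_le (hys : ys ∈ stdSimplex ℝ κ) (hAys : ∀ i, (A *ᵥ ys) i ≤ v)
    {q : κ → ℝ} (hq : 0 ≤ q) (hAq : (A - of fun _ _ => v) *ᵥ q ≤ 0) :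
    ∃ y ∈ stdSimplex ℝ κ, (∀ i, (A *ᵥ y) i ≤ v) ∧ (∀ j, y j = 0 → q j = 0) ∧
      ∀ i, ((A - of fun _ _ => v) *ᵥ q) i < 0 → (A *ᵥ y) i < v := by
  have hsum : 0 < ∑ j, (q + ys) j := by
    simp only [Pi.add_apply, Finset.sum_add_distrib, hys.2]
    linarith [Finset.sum_nonneg fun j (_ : j ∈ Finset.univ) => hq j]
  set s := ∑ j, (q + ys) j with hs
  have hexcess : ∀ i, (A *ᵥ (s⁻¹ • (q + ys))) i - v
      = s⁻¹ * (((A - of fun _ _ => v) *ᵥ q) i + ((A *ᵥ ys) i - v)) := fun i => by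
    have hadd := congrFun (mulVec_add (A - of fun _ _ => v) q ys) i
    rw [Pi.add_apply, sub_const_mulVec, ← hs, sub_const_mulVec _ _ ys, hys.2, mul_one] at hadd
    rw [← hadd, mulVec_smul, Pi.smul_apply, smul_eq_mul]
    field_simp
  refine ⟨s⁻¹ • (q + ys), inv_sum_smul_mem_stdSimplex (add_nonneg hq hys.1) hsum,
    fun i => sub_nonpos.1 ?_, fun j hj => ?_, fun i hi => sub_neg.1 ?_⟩
  · rw [hexcess]
    exact mul_nonpos_of_nonneg_of_nonpos (inv_nonneg.2 hsum.le)
      (add_nonpos (hAq i) (sub_nonpos.2 (hAys i)))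
  · have hzero : q j + ys j = 0 := (mul_eq_zero.1 hj).resolve_left (inv_ne_zero hsum.ne')
    exact ((add_eq_zero_iff_of_nonneg (hq j) (hys.1 j)).1 hzero).1
  · rw [hexcess]
    exact mul_neg_of_pos_of_neg (inv_pos.2 hsum)
      (add_neg_of_neg_of_nonpos hi (sub_nonpos.2 (hAys i)))

end Simplex

section Equilibrium

variable {ι κ : Type*} [Fintype ι] [Fintype κ] {A : Matrix ι κ ℝ} {v : ℝ}
  {x xs : ι → ℝ} {y ys : κ → ℝ}

theorem dotProduct_neg_transpose_mulVec (A : Matrix ι κ ℝ) (x : ι → ℝ) (y : κ → ℝ) :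
    y ⬝ᵥ (-Aᵀ *ᵥ x) = -(x ⬝ᵥ (A *ᵥ y)) := by
  rw [neg_mulVec, dotProduct_neg, mulVec_transpose, dotProduct_comm, dotProduct_mulVec]

/-- A pair of mixed strategies of the zero-sum game `A` guaranteeing the value `v` to both players.
The payoffs of the column player are written with her own payoff matrix `-Aᵀ`, so that the two
players are interchangeable (`IsEquilibrium.swap`). -/
structure IsEquilibrium (A : Matrix ι κ ℝ) (v : ℝ) (x : ι → ℝ) (y : κ → ℝ) : Prop where
  left_mem : x ∈ stdSimplex ℝ ι
  right_mem : y ∈ stdSimplex ℝ κ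
  row_le : ∀ i, (A *ᵥ y) i ≤ v
  col_le : ∀ j, (-Aᵀ *ᵥ x) j ≤ -v

namespace IsEquilibrium

theorem swap (h : IsEquilibrium A v x y) : IsEquilibrium (-Aᵀ) (-v) y x where
  left_mem := h.right_mem
  right_mem := h.left_mem
  row_le := h.col_le
  col_le := by simpa using h.row_le

theorem le_payoff (h : IsEquilibrium A v xs ys) (hy : y ∈ stdSimplex ℝ κ) :
    v ≤ xs ⬝ᵥ (A *ᵥ y) := by
  have := dotProduct_le_of_mem_stdSimplex hy h.col_le
  rwa [dotProduct_neg_transpose_mulVec, neg_le_neg_iff] at this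

theorem payoff_le (h : IsEquilibrium A v xs ys) (hx : x ∈ stdSimplex ℝ ι) :
    x ⬝ᵥ (A *ᵥ ys) ≤ v :=
  dotProduct_le_of_mem_stdSimplex hx h.row_le

theorem value_le_of_indifferent (h : IsEquilibrium A v xs ys) (hy : y ∈ stdSimplex ℝ κ) {c : ℝ}
    (hc : ∀ i, xs i ≠ 0 → (A *ᵥ y) i = c) : v ≤ c :=
  (h.le_payoff hy).trans_eq (dotProduct_eq_of_forall_ne_zero h.left_mem hc)

end IsEquilibrium

theorem exists_isEquilibrium [Nonempty ι] [Nonempty κ] (A : Matrix ι κ ℝ) :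
    ∃ v x y, IsEquilibrium A v x y := by
  classical
  have hlin_y (x : ι → ℝ) : IsLinearMap ℝ fun y : κ → ℝ => x ⬝ᵥ (A *ᵥ y) :=
    ⟨fun a b => by rw [mulVec_add, dotProduct_add],
      fun c a => by rw [mulVec_smul, dotProduct_smul]⟩
  have hlin_x (y : κ → ℝ) : IsLinearMap ℝ fun x : ι → ℝ => x ⬝ᵥ (A *ᵥ y) :=
    ⟨fun a b => add_dotProduct _ _ _, fun c a => smul_dotProduct _ _ _⟩
  have hcont_y (x : ι → ℝ) : Continuous fun y : κ → ℝ => x ⬝ᵥ (A *ᵥ y) := by fun_prop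
  have hcont_x (y : κ → ℝ) : Continuous fun x : ι → ℝ => x ⬝ᵥ (A *ᵥ y) := by fun_prop
  obtain ⟨y, hy, x, hx, hsaddle⟩ := Sion.exists_isSaddlePointOn
    (X := stdSimplex ℝ κ) (Y := stdSimplex ℝ ι) (f := fun y x => x ⬝ᵥ (A *ᵥ y))
    Set.Nonempty.of_subtype (convex_stdSimplex ℝ κ) (isCompact_stdSimplex ℝ κ)
    (fun x _ => (hcont_y x).lowerSemicontinuous.lowerSemicontinuousOn _)
    (fun x _ => ((hlin_y x).mk'.convexOn (convex_stdSimplex ℝ κ)).quasiconvexOn)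
    (convex_stdSimplex ℝ ι) Set.Nonempty.of_subtype (isCompact_stdSimplex ℝ ι)
    (fun y _ => (hcont_x y).upperSemicontinuous.upperSemicontinuousOn _)
    (fun y _ => ((hlin_x y).mk'.concaveOn (convex_stdSimplex ℝ ι)).quasiconcaveOn)
  refine ⟨x ⬝ᵥ (A *ᵥ y), x, y, hx, hy, fun i => ?_, fun j => ?_⟩
  · simpa using hsaddle y hy (Pi.single i 1) (single_mem_stdSimplex ℝ i)
  · have := hsaddle (Pi.single j 1) (single_mem_stdSimplex ℝ j) x hx
    rwa [← single_one_dotProduct j (-Aᵀ *ᵥ x), dotProduct_neg_transpose_mulVec, neg_le_neg_iff]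

theorem IsEquilibrium.exists_strict (h : IsEquilibrium A v xs ys) :
    ∃ x y, IsEquilibrium A v x y ∧ (∀ i, x i = 0 → (A *ᵥ y) i < v) ∧
      ∀ j, y j = 0 → (-Aᵀ *ᵥ x) j < -v := by
  have htranspose : -(A - of fun _ _ => v)ᵀ = -Aᵀ - of fun _ _ => -v := by
    ext
    simp [add_comm, sub_eq_add_neg]
  obtain ⟨p, q, hp, hAp, hq, hAq, hp_lt, hq_lt⟩ :=
    exists_strictly_complementary (A - of fun _ _ => v)
  rw [htranspose] at hAp hq_lt
  obtain ⟨x, hx, hAx, hx_zero, hx_lt⟩ := exists_mem_stdSimplex_mulVec_le h.left_mem h.col_le hp hAp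
  obtain ⟨y, hy, hAy, hy_zero, hy_lt⟩ := exists_mem_stdSimplex_mulVec_le h.right_mem h.row_le hq hAq
  exact ⟨x, y, ⟨hx, hy, hAy, hAx⟩, fun i hi => hy_lt i ((hp_lt i).trans_eq (hx_zero i hi)),
    fun j hj => hx_lt j ((hq_lt j).trans_eq (hy_zero j hj))⟩

theorem eventually_mulVec_mix_le {ι : Type*} [Finite ι] {A : Matrix ι κ ℝ}
    (hys : ∀ i, (A *ᵥ ys) i ≤ v) (hy : ∀ i, (A *ᵥ ys) i < v ∨ (A *ᵥ y) i ≤ v) :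
    ∀ᶠ ε : ℝ in 𝓝[>] 0, ∀ i, (A *ᵥ ((1 - ε) • ys + ε • y)) i ≤ v := by
  refine eventually_all.2 fun i => ?_
  have hmix : ∀ ε : ℝ, (A *ᵥ ((1 - ε) • ys + ε • y)) i
      = (1 - ε) * (A *ᵥ ys) i + ε * (A *ᵥ y) i := fun ε => by
    rw [mulVec_add, mulVec_smul, mulVec_smul]
    rfl
  simp only [hmix]
  obtain hi | hi := hy i
  · have hlim : Tendsto (fun ε : ℝ => (1 - ε) * (A *ᵥ ys) i + ε * (A *ᵥ y) i) (𝓝 0)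
        (𝓝 ((A *ᵥ ys) i)) := Continuous.tendsto' (by fun_prop) _ _ (by ring)
    exact (hlim.mono_left nhdsWithin_le_nhds).eventually_le_const hi
  · filter_upwards [Ioo_mem_nhdsGT (zero_lt_one' ℝ)] with ε hε
    nlinarith [mul_le_mul_of_nonneg_left (hys i) (sub_nonneg.2 hε.2.le),
      mul_le_mul_of_nonneg_left hi hε.1.le]

theorem IsEquilibrium.exists_mix (h : IsEquilibrium A v xs ys) (hx : x ∈ stdSimplex ℝ ι)
    (hy : y ∈ stdSimplex ℝ κ) (hrow : ∀ i, (A *ᵥ ys) i < v ∨ (A *ᵥ y) i ≤ v)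
    (hcol : ∀ j, (-Aᵀ *ᵥ xs) j < -v ∨ (-Aᵀ *ᵥ x) j ≤ -v) :
    ∃ ε : ℝ, 0 < ε ∧
      IsEquilibrium A v ((1 - ε) • xs + ε • x) ((1 - ε) • ys + ε • y) := by
  obtain ⟨ε, ⟨hrow, hcol⟩, hε0, hε1⟩ := ((eventually_mulVec_mix_le h.row_le hrow).and
    (eventually_mulVec_mix_le h.col_le hcol)).and (Ioo_mem_nhdsGT (zero_lt_one' ℝ)) |>.exists
  have hε : 0 ≤ 1 - ε := sub_nonneg.2 hε1.le
  exact ⟨ε, hε0, convex_stdSimplex ℝ ι h.left_mem hx hε hε0.le (sub_add_cancel _ _),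
    convex_stdSimplex ℝ κ h.right_mem hy hε hε0.le (sub_add_cancel _ _), hrow, hcol⟩

end Equilibrium

section Optimal

variable {n m : ℕ} {A : Matrix (Fin n) (Fin m) ℝ} {v : ℝ} {x : Fin n → ℝ} {y : Fin m → ℝ}

theorem bddAbove_range_dotProduct {ι : Type*} [Fintype ι] (f : ι → ℝ) :
    BddAbove (Set.range fun p : stdSimplex ℝ ι => (p : ι → ℝ) ⬝ᵥ f) :=
  ⟨∑ i, |f i|, by
    rintro _ ⟨p, rfl⟩
    exact dotProduct_le_of_mem_stdSimplex p.2 fun i => (le_abs_self (f i)).trans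
      (Finset.single_le_sum (f := fun i => |f i|) (fun _ _ => abs_nonneg _) (Finset.mem_univ i))⟩

theorem bddBelow_range_payoff (A : Matrix (Fin n) (Fin m) ℝ) (x : Fin n → ℝ) :
    BddBelow (Set.range fun y : stdSimplex ℝ (Fin m) => x ⬝ᵥ (A *ᵥ (y : Fin m → ℝ))) := by
  have h := (bddAbove_range_dotProduct (-Aᵀ *ᵥ x)).range_neg
  simpa only [dotProduct_neg_transpose_mulVec, neg_neg] using h

theorem IsEquilibrium.isOptimal (h : IsEquilibrium A v x y) : IsOptimal A x y := by
  have : Nonempty (stdSimplex ℝ (Fin n)) := ⟨⟨x, h.left_mem⟩⟩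
  have : Nonempty (stdSimplex ℝ (Fin m)) := ⟨⟨y, h.right_mem⟩⟩
  refine ⟨h.left_mem, h.right_mem, fun y' hy' => ?_, fun x' hx' => ?_⟩
  · calc maxPayoff A y ≤ v := ciSup_le fun x' => h.payoff_le x'.2
      _ ≤ x ⬝ᵥ (A *ᵥ y') := h.le_payoff hy'
      _ ≤ maxPayoff A y' := le_ciSup (bddAbove_range_dotProduct (A *ᵥ y')) ⟨x, h.left_mem⟩
  · calc minPayoff A x' ≤ x' ⬝ᵥ (A *ᵥ y) := ciInf_le (bddBelow_range_payoff A x') ⟨y, h.right_mem⟩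
      _ ≤ v := h.payoff_le hx'
      _ ≤ minPayoff A x := le_ciInf fun y' => h.le_payoff y'.2

end Optimal

section Reweight

variable {k : ℕ} {p u : Fin k → ℝ}

theorem sum_mul_exp_pos (hp : p ∈ stdSimplex ℝ (Fin k)) (u : Fin k → ℝ) :
    0 < ∑ j, p j * Real.exp (u j) :=
  (Real.exp_pos _).trans_le
    (convexOn_exp.map_sum_le (fun j _ => hp.1 j) hp.2 fun j _ => Set.mem_univ (u j))

theorem reweight_mem_simplexInterior (hp : p ∈ simplexInterior k) (u : Fin k → ℝ) :
    reweight p u ∈ simplexInterior k := by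
  have hZ := sum_mul_exp_pos hp.1 u
  have hpos : ∀ i, 0 < reweight p u i := fun i =>
    div_pos (mul_pos (hp.2 i) (Real.exp_pos _)) hZ
  refine ⟨⟨fun i => (hpos i).le, ?_⟩, hpos⟩
  simp only [reweight, ← Finset.sum_div, div_self hZ.ne']

theorem reweight_zero (hp : p ∈ stdSimplex ℝ (Fin k)) : reweight p 0 = p := by
  funext i
  simp [reweight, hp.2]

theorem reweight_reweight (hp : p ∈ stdSimplex ℝ (Fin k)) (u w : Fin k → ℝ) :
    reweight (reweight p u) w = reweight p (u + w) := by
  have hterm : ∀ j, reweight p u j * Real.exp (w j)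
      = p j * Real.exp ((u + w) j) / ∑ j, p j * Real.exp (u j) := fun j => by
    rw [reweight, Pi.add_apply, Real.exp_add]
    ring
  funext i
  change reweight p u i * Real.exp (w i) / ∑ j, reweight p u j * Real.exp (w j) = _
  simp only [hterm, ← Finset.sum_div]
  exact div_div_div_cancel_right₀ (sum_mul_exp_pos hp u).ne' _ _

theorem eq_log_of_reweight_eq_self (hp : p ∈ stdSimplex ℝ (Fin k)) (h : reweight p u = p)
    {i : Fin k} (hi : p i ≠ 0) : u i = Real.log (∑ j, p j * Real.exp (u j)) := by
  have hfix : p i * Real.exp (u i) = p i * ∑ j, p j * Real.exp (u j) :=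
    (div_eq_iff (sum_mul_exp_pos hp u).ne').1 (congrFun h i)
  rw [← mul_left_cancel₀ hi hfix, Real.log_exp]

theorem eq_dotProduct_of_reweight_eq_self (hp : p ∈ stdSimplex ℝ (Fin k)) (h : reweight p u = p)
    {i : Fin k} (hi : p i ≠ 0) : u i = p ⬝ᵥ u := by
  rw [dotProduct_eq_of_forall_ne_zero hp fun j hj => eq_log_of_reweight_eq_self hp h hj]
  exact eq_log_of_reweight_eq_self hp h hi

section Limit

variable {τ : Type*} {l : Filter τ} {P g : τ → Fin k → ℝ}

theorem tendsto_mul_exp (hP : Tendsto P l (𝓝 p)) (hg : Tendsto g l (𝓝 u)) (i : Fin k) :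
    Tendsto (fun t => P t i * Real.exp (g t i)) l (𝓝 (p i * Real.exp (u i))) :=
  (tendsto_pi_nhds.1 hP i).mul ((tendsto_pi_nhds.1 hg i).rexp)

theorem tendsto_sum_mul_exp (hP : Tendsto P l (𝓝 p)) (hg : Tendsto g l (𝓝 u)) :
    Tendsto (fun t => ∑ j, P t j * Real.exp (g t j)) l (𝓝 (∑ j, p j * Real.exp (u j))) :=
  tendsto_finsetSum _ fun j _ => tendsto_mul_exp hP hg j

theorem tendsto_reweight (hp : p ∈ stdSimplex ℝ (Fin k)) (hP : Tendsto P l (𝓝 p))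
    (hg : Tendsto g l (𝓝 u)) :
    Tendsto (fun t => reweight (P t) (g t)) l (𝓝 (reweight p u)) :=
  tendsto_pi_nhds.2 fun i =>
    (tendsto_mul_exp hP hg i).div (tendsto_sum_mul_exp hP hg) (sum_mul_exp_pos hp u).ne'

end Limit

theorem le_dotProduct_of_tendsto_reweight {P g : ℕ → Fin k → ℝ}
    (hmem : ∀ t, P t ∈ simplexInterior k) (hsucc : ∀ t, P (t + 1) = reweight (P t) (g t))
    (hp : p ∈ stdSimplex ℝ (Fin k)) (hP : Tendsto P atTop (𝓝 p)) (hg : Tendsto g atTop (𝓝 u))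
    (i : Fin k) : u i ≤ p ⬝ᵥ u := by
  by_contra! hlt
  have hfix : reweight p u = p := by
    have hlim := tendsto_reweight hp hP hg
    simp only [← hsucc] at hlim
    exact tendsto_nhds_unique hlim (hP.comp (tendsto_add_atTop_nat 1))
  obtain hi | hi := eq_or_ne (p i) 0
  swap
  · exact hlt.ne' (eq_dotProduct_of_reweight_eq_self hp hfix hi)
  have hZ : ∑ j, p j * Real.exp (u j) < Real.exp (u i) := by
    rwa [← Real.log_lt_iff_lt_exp (sum_mul_exp_pos hp u),
      ← dotProduct_eq_of_forall_ne_zero hp fun j hj => eq_log_of_reweight_eq_self hp hfix hj]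
  obtain ⟨T, hT⟩ := eventually_atTop.1 <| (tendsto_sum_mul_exp hP hg).eventually_lt
    (tendsto_pi_nhds.1 hg i).rexp hZ
  have hmono : Monotone fun t => P (t + T) i := monotone_nat_of_le_succ fun t => by
    rw [add_right_comm, hsucc, reweight, le_div_iff₀ (sum_mul_exp_pos (hmem _).1 _)]
    exact mul_le_mul_of_nonneg_left (hT _ (Nat.le_add_left T t)).le ((hmem _).2 i).le
  have hle : P (0 + T) i ≤ p i :=
    hmono.ge_of_tendsto ((tendsto_pi_nhds.1 hP i).comp (tendsto_add_atTop_nat T)) 0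
  exact (((hmem _).2 i).trans_le hle).ne' hi

end Reweight

section CrossEntropy

variable {k : ℕ} {p r : Fin k → ℝ}

/-- The cross entropy `-∑ i, r i * log (p i)` of `p` relative to `r`; its excess over
`crossEntropy r r` is the Kullback–Leibler divergence of `r` from `p`. Since `Real.log 0 = 0`, it
has this meaning only where `p` vanishes at no point of the support of `r`. -/
noncomputable def crossEntropy (r p : Fin k → ℝ) : ℝ :=
  -(r ⬝ᵥ fun i => Real.log (p i))

theorem crossEntropy_add (a b p : Fin k → ℝ) :
    crossEntropy (a + b) p = crossEntropy a p + crossEntropy b p := by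
  simp only [crossEntropy, add_dotProduct, neg_add]

theorem crossEntropy_smul (c : ℝ) (r p : Fin k → ℝ) :
    crossEntropy (c • r) p = c * crossEntropy r p := by
  simp only [crossEntropy, smul_dotProduct, smul_eq_mul, mul_neg]

theorem neg_mul_log_nonneg (hr : r ∈ stdSimplex ℝ (Fin k)) (hp : p ∈ simplexInterior k)
    (i : Fin k) : 0 ≤ -(r i * Real.log (p i)) :=
  neg_nonneg.2 <| mul_nonpos_of_nonneg_of_nonpos (hr.1 i) <|
    Real.log_nonpos (hp.2 i).le (mem_Icc_of_mem_stdSimplex hp.1 i).2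

theorem crossEntropy_nonneg (hr : r ∈ stdSimplex ℝ (Fin k)) (hp : p ∈ simplexInterior k) :
    0 ≤ crossEntropy r p := by
  rw [crossEntropy, dotProduct, ← Finset.sum_neg_distrib]
  exact Finset.sum_nonneg fun i _ => neg_mul_log_nonneg hr hp i

theorem exp_neg_div_le_of_crossEntropy_le (hr : r ∈ stdSimplex ℝ (Fin k))
    (hp : p ∈ simplexInterior k) {C : ℝ} (hC : crossEntropy r p ≤ C) {i : Fin k}
    (hi : r i ≠ 0) : Real.exp (-(C / r i)) ≤ p i := by
  rw [crossEntropy, dotProduct, ← Finset.sum_neg_distrib] at hC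
  have hle : -(r i * Real.log (p i)) ≤ C :=
    (Finset.single_le_sum (fun j _ => neg_mul_log_nonneg hr hp j) (Finset.mem_univ i)).trans hC
  rw [← Real.le_log_iff_exp_le (hp.2 i), ← neg_div, div_le_iff₀ ((hr.1 i).lt_of_ne' hi)]
  linarith

theorem tendsto_crossEntropy {τ : Type*} {l : Filter τ} {P : τ → Fin k → ℝ}
    (hP : Tendsto P l (𝓝 p)) (hsupp : ∀ i, r i ≠ 0 → p i ≠ 0) :
    Tendsto (fun t => crossEntropy r (P t)) l (𝓝 (crossEntropy r p)) := by
  refine (tendsto_finsetSum _ fun i _ => ?_).neg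
  obtain hi | hi := eq_or_ne (r i) 0
  · simp only [hi, zero_mul, tendsto_const_nhds]
  · exact ((tendsto_pi_nhds.1 hP i).log (hsupp i hi)).const_mul _

theorem crossEntropy_reweight (hr : r ∈ stdSimplex ℝ (Fin k)) (hp : p ∈ simplexInterior k)
    (u : Fin k → ℝ) : crossEntropy r (reweight p u)
      = crossEntropy r p - r ⬝ᵥ u + Real.log (∑ j, p j * Real.exp (u j)) := by
  set Z := ∑ j, p j * Real.exp (u j)
  have hlog : (fun i => Real.log (reweight p u i))
      = (fun i => Real.log (p i)) + u - fun _ => Real.log Z := by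
    funext i
    rw [reweight, Real.log_div (mul_pos (hp.2 i) (Real.exp_pos _)).ne' (sum_mul_exp_pos hp.1 u).ne',
      Real.log_mul (hp.2 i).ne' (Real.exp_pos _).ne', Real.log_exp]
    rfl
  have hconst : r ⬝ᵥ (fun _ => Real.log Z) = Real.log Z :=
    dotProduct_eq_of_forall_ne_zero hr fun _ _ => rfl
  rw [crossEntropy, hlog, dotProduct_sub, dotProduct_add, hconst, crossEntropy]
  ring

theorem sq_sub_le_sq_mul_log {s t : ℝ} (hs : 0 ≤ s) (ht : 0 < t) :
    (s - t) ^ 2 ≤ s ^ 2 * (Real.log (s ^ 2) - Real.log (t ^ 2)) - s ^ 2 + t ^ 2 := by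
  obtain rfl | hs := hs.eq_or_lt
  · simp
  have hlog : Real.log t - Real.log s ≤ t / s - 1 := by
    rw [← Real.log_div ht.ne' hs.ne']
    exact Real.log_le_sub_one_of_pos (div_pos ht hs)
  have hmul : s ^ 2 * (Real.log t - Real.log s) ≤ s * t - s ^ 2 :=
    (mul_le_mul_of_nonneg_left hlog (sq_nonneg s)).trans_eq (by field_simp)
  rw [Real.log_pow, Real.log_pow]
  push_cast
  linarith

theorem sq_sub_div_four_le_mul_log {a b : ℝ} (ha : 0 ≤ a) (ha1 : a ≤ 1) (hb : 0 < b)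
    (hb1 : b ≤ 1) : (a - b) ^ 2 / 4 ≤ a * (Real.log a - Real.log b) - a + b := by
  have hsqrt := sq_sub_le_sq_mul_log (Real.sqrt_nonneg a) (Real.sqrt_pos.2 hb)
  rw [Real.sq_sqrt ha, Real.sq_sqrt hb.le] at hsqrt
  have hfactor : (a - b) ^ 2 = (√a - √b) ^ 2 * (√a + √b) ^ 2 := by
    rw [← mul_pow, mul_comm, ← sq_sub_sq, Real.sq_sqrt ha, Real.sq_sqrt hb.le]
  have hsum : (√a + √b) ^ 2 ≤ 2 ^ 2 := pow_le_pow_left₀ (by positivity)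
    (by linarith [Real.sqrt_le_one.2 ha1, Real.sqrt_le_one.2 hb1]) 2
  rw [hfactor]
  linarith [mul_le_mul_of_nonneg_left hsum (sq_nonneg (√a - √b))]

theorem sq_norm_sub_le_crossEntropy_sub (hr : r ∈ stdSimplex ℝ (Fin k))
    (hp : p ∈ simplexInterior k) : ‖r - p‖ ^ 2 / 4 ≤ crossEntropy r p - crossEntropy r r := by
  have hsum : ∑ i, (r i - p i) ^ 2 / 4 ≤ crossEntropy r p - crossEntropy r r := by
    calc ∑ i, (r i - p i) ^ 2 / 4
        ≤ ∑ i, (r i * (Real.log (r i) - Real.log (p i)) - r i + p i) :=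
          Finset.sum_le_sum fun i _ => sq_sub_div_four_le_mul_log (hr.1 i)
            (mem_Icc_of_mem_stdSimplex hr i).2 (hp.2 i) (mem_Icc_of_mem_stdSimplex hp.1 i).2
      _ = crossEntropy r p - crossEntropy r r := by
          simp only [crossEntropy, dotProduct, mul_sub, Finset.sum_add_distrib,
            Finset.sum_sub_distrib, hr.2, hp.1.2]
          ring
  have hnorm : ‖r - p‖ ≤ √(4 * (crossEntropy r p - crossEntropy r r)) := by
    refine (pi_norm_le_iff_of_nonneg (Real.sqrt_nonneg _)).2 fun i => Real.abs_le_sqrt ?_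
    have hi := Finset.single_le_sum (f := fun i => (r i - p i) ^ 2 / 4)
      (fun _ _ => by positivity) (Finset.mem_univ i)
    simp only [Pi.sub_apply]
    linarith
  have hnonneg : 0 ≤ crossEntropy r p - crossEntropy r r :=
    (Finset.sum_nonneg fun i _ => by positivity).trans hsum
  have hsq := (Real.le_sqrt (norm_nonneg _) (by positivity)).1 hnorm
  linarith

end CrossEntropy

section OptimisticHedge

variable {k : ℕ} {g p q : ℕ → Fin k → ℝ}

/-- `p` is played by optimistic entropic mirror descent against the gains `g`. The secondary
sequence `q` is updated with the gain just observed, whereas `p (t + 1)` is obtained from `q t` by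
using the last gain `g t` as a prediction of `g (t + 1)`. -/
structure IsOptimisticHedge (g p q : ℕ → Fin k → ℝ) : Prop where
  mem : ∀ t, p t ∈ simplexInterior k
  mem_hat : ∀ t, q t ∈ simplexInterior k
  succ : ∀ t, p (t + 1) = reweight (q t) (g t)
  succ_hat : ∀ t, q (t + 1) = reweight (q t) (g (t + 1))

theorem isOptimisticHedge_of_succ_succ (hmem : ∀ t, p t ∈ simplexInterior k)
    (hsucc : ∀ t, p (t + 2) = reweight (p (t + 1)) ((2 : ℝ) • g (t + 1) - g t)) :
    IsOptimisticHedge g p fun t => reweight (p (t + 1)) (-g t) where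
  mem := hmem
  mem_hat t := reweight_mem_simplexInterior (hmem _) _
  succ t := by rw [reweight_reweight (hmem _).1, neg_add_cancel, reweight_zero (hmem _).1]
  succ_hat t := by
    rw [reweight_reweight (hmem _).1, hsucc, reweight_reweight (hmem _).1]
    congr 1
    module

theorem IsOptimisticHedge.crossEntropy_succ_le (h : IsOptimisticHedge g p q) {r : Fin k → ℝ}
    (hr : r ∈ stdSimplex ℝ (Fin k)) (t : ℕ) :
    crossEntropy r (q (t + 1)) + ‖q (t + 1) - p (t + 1)‖ ^ 2 / 4 + ‖p (t + 1) - q t‖ ^ 2 / 4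
      ≤ crossEntropy r (q t) - (r - p (t + 1)) ⬝ᵥ g (t + 1)
        + (q (t + 1) - p (t + 1)) ⬝ᵥ (g (t + 1) - g t) := by
  have hq : ∀ s ∈ stdSimplex ℝ (Fin k), crossEntropy s (q (t + 1)) = crossEntropy s (q t)
      - s ⬝ᵥ g (t + 1) + Real.log (∑ j, q t j * Real.exp (g (t + 1) j)) := fun s hs => by
    rw [h.succ_hat, crossEntropy_reweight hs (h.mem_hat t)]
  have hp : ∀ s ∈ stdSimplex ℝ (Fin k), crossEntropy s (p (t + 1)) = crossEntropy s (q t)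
      - s ⬝ᵥ g t + Real.log (∑ j, q t j * Real.exp (g t j)) := fun s hs => by
    rw [h.succ, crossEntropy_reweight hs (h.mem_hat t)]
  have hqp := sq_norm_sub_le_crossEntropy_sub (h.mem_hat (t + 1)).1 (h.mem (t + 1))
  have hpq := sq_norm_sub_le_crossEntropy_sub (h.mem (t + 1)).1 (h.mem_hat t)
  rw [hq _ (h.mem_hat (t + 1)).1, hp _ (h.mem_hat (t + 1)).1] at hqp
  rw [hp _ (h.mem (t + 1)).1] at hpq
  rw [hq r hr, sub_dotProduct, sub_dotProduct, dotProduct_sub, dotProduct_sub]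
  linarith

end OptimisticHedge

section EntryNorm

variable {ι κ : Type*} [Fintype ι] [Fintype κ]

/-- The entrywise `ℓ¹` norm of a matrix, bounding its bilinear form in the sup norms. -/
def entryNorm (A : Matrix ι κ ℝ) : ℝ := ∑ i, ∑ j, |A i j|

theorem entryNorm_nonneg (A : Matrix ι κ ℝ) : 0 ≤ entryNorm A :=
  Finset.sum_nonneg fun _ _ => Finset.sum_nonneg fun _ _ => abs_nonneg _

theorem entryNorm_neg_transpose (A : Matrix ι κ ℝ) : entryNorm (-Aᵀ) = entryNorm A := by
  simpa [entryNorm] using Finset.sum_comm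

theorem dotProduct_mulVec_le_entryNorm (A : Matrix ι κ ℝ) (u : ι → ℝ) (w : κ → ℝ) :
    u ⬝ᵥ (A *ᵥ w) ≤ entryNorm A * (‖u‖ * ‖w‖) := by
  simp only [dotProduct, mulVec, Finset.mul_sum, entryNorm, Finset.sum_mul]
  refine Finset.sum_le_sum fun i _ => Finset.sum_le_sum fun j _ => ?_
  calc u i * (A i j * w j) ≤ |u i * (A i j * w j)| := le_abs_self _
    _ = |A i j| * (|u i| * |w j|) := by rw [abs_mul, abs_mul, mul_left_comm]
    _ ≤ |A i j| * (‖u‖ * ‖w‖) := by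
        gcongr
        exacts [norm_le_pi_norm u i, norm_le_pi_norm w j]

end EntryNorm

section Descent

theorem tendsto_of_add_le {Ψ D : ℕ → ℝ} (hΨ : ∀ t, 0 ≤ Ψ t) (hD : ∀ t, 0 ≤ D t)
    (h : ∀ t, Ψ (t + 1) + D t ≤ Ψ t) :
    (∃ L, Tendsto Ψ atTop (𝓝 L)) ∧ Tendsto D atTop (𝓝 0) := by
  have hanti : Antitone Ψ := antitone_nat_of_succ_le fun t => by linarith [h t, hD t]
  have hlim := tendsto_atTop_ciInf hanti ⟨0, by rintro _ ⟨t, rfl⟩; exact hΨ t⟩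
  have hdiff := hlim.sub (hlim.comp (tendsto_add_atTop_nat 1))
  rw [sub_self] at hdiff
  exact ⟨⟨_, hlim⟩, squeeze_zero hD (fun t => le_sub_iff_add_le'.2 (h t)) hdiff⟩

theorem tendsto_zero_of_sq_norm_le {τ E : Type*} [SeminormedAddCommGroup E] {l : Filter τ}
    {u : τ → E} {D : τ → ℝ} (h : ∀ t, ‖u t‖ ^ 2 ≤ D t) (hD : Tendsto D l (𝓝 0)) :
    Tendsto u l (𝓝 0) := by
  have hsqrt := hD.sqrt
  rw [Real.sqrt_zero] at hsqrt
  exact squeeze_zero_norm (fun t => Real.le_sqrt_of_sq_le (h t)) hsqrt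

end Descent

section Play

variable {n m : ℕ} {A : Matrix (Fin n) (Fin m) ℝ} {η v : ℝ}
  {X Xh : ℕ → Fin n → ℝ} {Y Yh : ℕ → Fin m → ℝ} {x xs : Fin n → ℝ} {y ys : Fin m → ℝ}

/-- A play of the zero-sum game `A` in which both players run optimistic hedge with secondary
sequences `Xh`, `Yh` and a stepsize `η` small enough for their prediction errors to be
absorbed. -/
structure IsPlay (A : Matrix (Fin n) (Fin m) ℝ) (η : ℝ) (X Xh : ℕ → Fin n → ℝ)
    (Y Yh : ℕ → Fin m → ℝ) : Prop where
  left : IsOptimisticHedge (fun t => η • (A *ᵥ Y t)) X Xh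
  right : IsOptimisticHedge (fun t => η • (-Aᵀ *ᵥ X t)) Y Yh
  stepsize_pos : 0 < η
  stepsize_le : 8 * (η * entryNorm A) ≤ 1

namespace IsPlay

theorem swap (h : IsPlay A η X Xh Y Yh) : IsPlay (-Aᵀ) η Y Yh X Xh where
  left := h.right
  right := by simpa using h.left
  stepsize_pos := h.stepsize_pos
  stepsize_le := by rw [entryNorm_neg_transpose]; exact h.stepsize_le

theorem crossEntropy_succ_le (h : IsPlay A η X Xh Y Yh) {r : Fin n → ℝ}
    (hr : r ∈ stdSimplex ℝ (Fin n)) (t : ℕ) :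
    crossEntropy r (Xh (t + 1)) + 3 / 16 * ‖Xh (t + 1) - X (t + 1)‖ ^ 2
        + ‖X (t + 1) - Xh t‖ ^ 2 / 4
      ≤ crossEntropy r (Xh t) - η * ((r - X (t + 1)) ⬝ᵥ (A *ᵥ Y (t + 1)))
        + (‖Y (t + 1) - Yh t‖ ^ 2 + ‖Yh t - Y t‖ ^ 2) / 8 := by
  have hregret := h.left.crossEntropy_succ_le hr t
  set a := ‖Xh (t + 1) - X (t + 1)‖
  set c := ‖Y (t + 1) - Yh t‖
  set d := ‖Yh t - Y t‖
  have hchange : ‖Y (t + 1) - Y t‖ ≤ c + d := norm_sub_le_norm_sub_add_norm_sub _ _ _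
  have hpredict : (Xh (t + 1) - X (t + 1)) ⬝ᵥ (η • (A *ᵥ Y (t + 1)) - η • (A *ᵥ Y t))
      ≤ a * (c + d) / 8 := by
    calc (Xh (t + 1) - X (t + 1)) ⬝ᵥ (η • (A *ᵥ Y (t + 1)) - η • (A *ᵥ Y t))
        = η * ((Xh (t + 1) - X (t + 1)) ⬝ᵥ (A *ᵥ (Y (t + 1) - Y t))) := by
          rw [← smul_sub, ← mulVec_sub, dotProduct_smul, smul_eq_mul]
      _ ≤ η * (entryNorm A * (a * ‖Y (t + 1) - Y t‖)) :=
          mul_le_mul_of_nonneg_left (dotProduct_mulVec_le_entryNorm A _ _) h.stepsize_pos.le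
      _ = η * entryNorm A * (a * ‖Y (t + 1) - Y t‖) := (mul_assoc _ _ _).symm
      _ ≤ 1 / 8 * (a * (c + d)) := by
          have := h.stepsize_le
          gcongr
          linarith
      _ = a * (c + d) / 8 := by ring
  rw [dotProduct_smul, smul_eq_mul] at hregret
  nlinarith [sq_nonneg (a - (c + d)), sq_nonneg (c - d)]

theorem potential_succ_le (h : IsPlay A η X Xh Y Yh) (heq : IsEquilibrium A v xs ys) (t : ℕ) :
    crossEntropy xs (Xh (t + 1)) + crossEntropy ys (Yh (t + 1))
        + 3 / 16 * (‖Xh (t + 1) - X (t + 1)‖ ^ 2 + ‖Yh (t + 1) - Y (t + 1)‖ ^ 2)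
        + ((‖Xh t - X t‖ ^ 2 + ‖Yh t - Y t‖ ^ 2) / 16
          + (‖X (t + 1) - Xh t‖ ^ 2 + ‖Y (t + 1) - Yh t‖ ^ 2) / 8)
      ≤ crossEntropy xs (Xh t) + crossEntropy ys (Yh t)
        + 3 / 16 * (‖Xh t - X t‖ ^ 2 + ‖Yh t - Y t‖ ^ 2) := by
  have hgap : 0 ≤ (xs - X (t + 1)) ⬝ᵥ (A *ᵥ Y (t + 1))
      + (ys - Y (t + 1)) ⬝ᵥ (-Aᵀ *ᵥ X (t + 1)) := by
    have hx := heq.le_payoff (h.right.mem (t + 1)).1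
    have hy := heq.swap.le_payoff (h.left.mem (t + 1)).1
    rw [sub_dotProduct, sub_dotProduct, dotProduct_neg_transpose_mulVec A _ (Y (t + 1))]
    linarith
  have hleft := h.crossEntropy_succ_le heq.left_mem t
  have hright := h.swap.crossEntropy_succ_le heq.right_mem t
  linarith [mul_nonneg h.stepsize_pos.le hgap]

theorem tendsto_potential (h : IsPlay A η X Xh Y Yh) (heq : IsEquilibrium A v xs ys) :
    (∃ L, Tendsto (fun t => crossEntropy xs (Xh t) + crossEntropy ys (Yh t)) atTop (𝓝 L)) ∧
      Tendsto (fun t => Xh t - X t) atTop (𝓝 0) ∧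
      Tendsto (fun t => X (t + 1) - Xh t) atTop (𝓝 0) := by
  set Φ := fun t => crossEntropy xs (Xh t) + crossEntropy ys (Yh t)
  set G := fun t => ‖Xh t - X t‖ ^ 2 + ‖Yh t - Y t‖ ^ 2
  have hpotential_nonneg : ∀ t, 0 ≤ Φ t + 3 / 16 * G t := fun t => by
    have := crossEntropy_nonneg heq.left_mem (h.left.mem_hat t)
    have := crossEntropy_nonneg heq.right_mem (h.right.mem_hat t)
    positivity
  obtain ⟨⟨L, hL⟩, hdrop⟩ :=
    tendsto_of_add_le hpotential_nonneg (fun t => by positivity) (h.potential_succ_le heq)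
  have hG : Tendsto G atTop (𝓝 0) := by
    refine squeeze_zero (fun t => by positivity) (fun t => ?_) (by simpa using hdrop.const_mul 16)
    linarith [sq_nonneg ‖X (t + 1) - Xh t‖, sq_nonneg ‖Y (t + 1) - Yh t‖]
  refine ⟨⟨L, ?_⟩,
    tendsto_zero_of_sq_norm_le (fun t => le_add_of_nonneg_right (sq_nonneg _)) hG,
    tendsto_zero_of_sq_norm_le (fun t => ?_) (by simpa using hdrop.const_mul 8)⟩
  · have hsub := hL.sub (hG.const_mul (3 / 16))
    rw [mul_zero, sub_zero] at hsub
    exact hsub.congr fun t => add_sub_cancel_right _ _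
  · linarith [sq_nonneg ‖Xh t - X t‖, sq_nonneg ‖Yh t - Y t‖, sq_nonneg ‖Y (t + 1) - Yh t‖]

end IsPlay

end Play

section ClusterPoint

variable {n m : ℕ} {A : Matrix (Fin n) (Fin m) ℝ} {η v : ℝ}
  {X Xh : ℕ → Fin n → ℝ} {Y Yh : ℕ → Fin m → ℝ} {x xs : Fin n → ℝ} {y ys : Fin m → ℝ}
  {l : Filter ℕ}

namespace IsPlay

theorem tendsto_hat (h : IsPlay A η X Xh Y Yh) (heq : IsEquilibrium A v xs ys) (hl : l ≤ atTop)
    (hX : Tendsto X l (𝓝 x)) : Tendsto Xh l (𝓝 x) := by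
  simpa using ((h.tendsto_potential heq).2.1.mono_left hl).add hX

theorem tendsto_succ (h : IsPlay A η X Xh Y Yh) (heq : IsEquilibrium A v xs ys) (hl : l ≤ atTop)
    (hX : Tendsto X l (𝓝 x)) : Tendsto (fun t => X (t + 1)) l (𝓝 x) := by
  simpa using ((h.tendsto_potential heq).2.2.mono_left hl).add (h.tendsto_hat heq hl hX)

theorem tendsto_hat_succ (h : IsPlay A η X Xh Y Yh) (heq : IsEquilibrium A v xs ys)
    (hl : l ≤ atTop) (hX : Tendsto X l (𝓝 x)) : Tendsto (fun t => Xh (t + 1)) l (𝓝 x) := by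
  have hlag := (h.tendsto_potential heq).2.1.comp (tendsto_add_atTop_nat 1)
  simpa using (hlag.mono_left hl).add (h.tendsto_succ heq hl hX)

theorem tendsto_gain_succ (h : IsPlay A η X Xh Y Yh) (heq : IsEquilibrium A v xs ys)
    (hl : l ≤ atTop) (hY : Tendsto Y l (𝓝 y)) :
    Tendsto (fun t => η • (A *ᵥ Y (t + 1))) l (𝓝 (η • (A *ᵥ y))) := by
  have hcont : Continuous fun y : Fin m → ℝ => η • (A *ᵥ y) := by fun_prop
  exact (hcont.tendsto y).comp (h.swap.tendsto_succ heq.swap hl hY)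

theorem reweight_eq_self [l.NeBot] (h : IsPlay A η X Xh Y Yh) (heq : IsEquilibrium A v xs ys)
    (hl : l ≤ atTop) (hx : x ∈ stdSimplex ℝ (Fin n)) (hX : Tendsto X l (𝓝 x))
    (hY : Tendsto Y l (𝓝 y)) : reweight x (η • (A *ᵥ y)) = x := by
  have hlim := tendsto_reweight hx (h.tendsto_hat heq hl hX) (h.tendsto_gain_succ heq hl hY)
  simp only [← h.left.succ_hat] at hlim
  exact tendsto_nhds_unique hlim (h.tendsto_hat_succ heq hl hX)

theorem mulVec_eq_payoff [l.NeBot] (h : IsPlay A η X Xh Y Yh) (heq : IsEquilibrium A v xs ys)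
    (hl : l ≤ atTop) (hx : x ∈ stdSimplex ℝ (Fin n)) (hX : Tendsto X l (𝓝 x))
    (hY : Tendsto Y l (𝓝 y)) {i : Fin n} (hi : x i ≠ 0) :
    (A *ᵥ y) i = x ⬝ᵥ (A *ᵥ y) := by
  have hgain := eq_dotProduct_of_reweight_eq_self hx (h.reweight_eq_self heq hl hx hX hY) hi
  rw [Pi.smul_apply, dotProduct_smul] at hgain
  exact mul_left_cancel₀ h.stepsize_pos.ne' hgain

theorem ne_zero_of_tendsto [l.NeBot] (h : IsPlay A η X Xh Y Yh) (heq : IsEquilibrium A v xs ys)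
    (hl : l ≤ atTop) (hX : Tendsto X l (𝓝 x)) {i : Fin n} (hi : xs i ≠ 0) : x i ≠ 0 := by
  obtain ⟨L, hL⟩ := (h.tendsto_potential heq).1
  have hbound : ∀ᶠ t in l, Real.exp (-((L + 1) / xs i)) ≤ Xh t i := by
    filter_upwards [hl (hL.eventually_le_const (lt_add_one L))] with t ht
    have hright := crossEntropy_nonneg heq.right_mem (h.right.mem_hat t)
    exact exp_neg_div_le_of_crossEntropy_le heq.left_mem (h.left.mem_hat t) (by linarith) hi
  have hlim := tendsto_pi_nhds.1 (h.tendsto_hat heq hl hX) i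
  exact ((Real.exp_pos _).trans_le (ge_of_tendsto hlim hbound)).ne'

theorem value_le_payoff [l.NeBot] (h : IsPlay A η X Xh Y Yh) (heq : IsEquilibrium A v xs ys)
    (hl : l ≤ atTop) (hx : x ∈ stdSimplex ℝ (Fin n)) (hy : y ∈ stdSimplex ℝ (Fin m))
    (hX : Tendsto X l (𝓝 x)) (hY : Tendsto Y l (𝓝 y)) : v ≤ x ⬝ᵥ (A *ᵥ y) :=
  heq.value_le_of_indifferent hy fun _ hi =>
    h.mulVec_eq_payoff heq hl hx hX hY (h.ne_zero_of_tendsto heq hl hX hi)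

theorem payoff_eq_value [l.NeBot] (h : IsPlay A η X Xh Y Yh) (heq : IsEquilibrium A v xs ys)
    (hl : l ≤ atTop) (hx : x ∈ stdSimplex ℝ (Fin n)) (hy : y ∈ stdSimplex ℝ (Fin m))
    (hX : Tendsto X l (𝓝 x)) (hY : Tendsto Y l (𝓝 y)) : x ⬝ᵥ (A *ᵥ y) = v := by
  have hright := h.swap.value_le_payoff heq.swap hl hy hx hY hX
  rw [dotProduct_neg_transpose_mulVec, neg_le_neg_iff] at hright
  exact hright.antisymm (h.value_le_payoff heq hl hx hy hX hY)

theorem exists_equilibrium_mix [l.NeBot] (h : IsPlay A η X Xh Y Yh)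
    (heq : IsEquilibrium A v xs ys) (hl : l ≤ atTop) (hx : x ∈ stdSimplex ℝ (Fin n))
    (hy : y ∈ stdSimplex ℝ (Fin m)) (hX : Tendsto X l (𝓝 x)) (hY : Tendsto Y l (𝓝 y)) :
    ∃ x' y', IsEquilibrium A v x' y' ∧ ∃ ε : ℝ, 0 < ε ∧
      IsEquilibrium A v ((1 - ε) • x' + ε • x) ((1 - ε) • y' + ε • y) := by
  obtain ⟨x', y', heq', hrow, hcol⟩ := heq.exists_strict
  have hvalue := h.payoff_eq_value heq' hl hx hy hX hY
  refine ⟨x', y', heq', heq'.exists_mix hx hy (fun i => ?_) fun j => ?_⟩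
  · refine or_iff_not_imp_left.2 fun hi => ?_
    have hxi := h.ne_zero_of_tendsto heq' hl hX (mt (hrow i) hi)
    exact ((h.mulVec_eq_payoff heq hl hx hX hY hxi).trans hvalue).le
  · refine or_iff_not_imp_left.2 fun hj => ?_
    have hyj := h.swap.ne_zero_of_tendsto heq'.swap hl hY (mt (hcol j) hj)
    rw [h.swap.mulVec_eq_payoff heq.swap hl hy hY hX hyj, dotProduct_neg_transpose_mulVec, hvalue]

theorem tendsto_crossEntropy_add [l.NeBot] (h : IsPlay A η X Xh Y Yh)
    (heq : IsEquilibrium A v xs ys) (hl : l ≤ atTop) (hx : x ∈ stdSimplex ℝ (Fin n))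
    (hy : y ∈ stdSimplex ℝ (Fin m)) (hX : Tendsto X l (𝓝 x)) (hY : Tendsto Y l (𝓝 y)) :
    Tendsto (fun t => crossEntropy x (Xh t) + crossEntropy y (Yh t)) atTop
      (𝓝 (crossEntropy x x + crossEntropy y y)) := by
  obtain ⟨x', y', heq', ε, hε, hmix⟩ := h.exists_equilibrium_mix heq hl hx hy hX hY
  obtain ⟨L, hL⟩ := (h.tendsto_potential heq').1
  obtain ⟨M, hM⟩ := (h.tendsto_potential hmix).1
  have hlim : Tendsto (fun t => crossEntropy x (Xh t) + crossEntropy y (Yh t)) atTop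
      (𝓝 (ε⁻¹ * (M - (1 - ε) * L))) := by
    refine ((hM.sub (hL.const_mul (1 - ε))).const_mul ε⁻¹).congr fun t => ?_
    rw [inv_mul_eq_iff_eq_mul₀ hε.ne']
    simp only [crossEntropy_add, crossEntropy_smul]
    ring
  have hcluster := (tendsto_crossEntropy (h.tendsto_hat heq hl hX) fun _ hi => hi).add
    (tendsto_crossEntropy (h.swap.tendsto_hat heq.swap hl hY) fun _ hj => hj)
  rwa [tendsto_nhds_unique (hlim.mono_left hl) hcluster] at hlim

theorem tendsto_left [l.NeBot] (h : IsPlay A η X Xh Y Yh) (heq : IsEquilibrium A v xs ys)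
    (hl : l ≤ atTop) (hx : x ∈ stdSimplex ℝ (Fin n)) (hy : y ∈ stdSimplex ℝ (Fin m))
    (hX : Tendsto X l (𝓝 x)) (hY : Tendsto Y l (𝓝 y)) : Tendsto X atTop (𝓝 x) := by
  have hdiv := ((h.tendsto_crossEntropy_add heq hl hx hy hX hY).sub_const
    (crossEntropy x x + crossEntropy y y)).const_mul 4
  rw [sub_self, mul_zero] at hdiv
  have hhat : Tendsto (fun t => x - Xh t) atTop (𝓝 0) := by
    refine tendsto_zero_of_sq_norm_le (fun t => ?_) hdiv
    have hleft := sq_norm_sub_le_crossEntropy_sub hx (h.left.mem_hat t)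
    have hright := sq_norm_sub_le_crossEntropy_sub hy (h.right.mem_hat t)
    linarith [sq_nonneg ‖y - Yh t‖]
  simpa using (hhat.add (h.tendsto_potential heq).2.1).const_sub x

theorem isEquilibrium_of_tendsto (h : IsPlay A η X Xh Y Yh) (heq : IsEquilibrium A v xs ys)
    (hx : x ∈ stdSimplex ℝ (Fin n)) (hy : y ∈ stdSimplex ℝ (Fin m))
    (hX : Tendsto X atTop (𝓝 x)) (hY : Tendsto Y atTop (𝓝 y)) : IsEquilibrium A v x y := by
  have hvalue := h.payoff_eq_value heq le_rfl hx hy hX hY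
  have hrow := le_dotProduct_of_tendsto_reweight h.left.mem_hat h.left.succ_hat hx
    (h.tendsto_hat heq le_rfl hX) (h.tendsto_gain_succ heq le_rfl hY)
  have hcol := le_dotProduct_of_tendsto_reweight h.right.mem_hat h.right.succ_hat hy
    (h.swap.tendsto_hat heq.swap le_rfl hY) (h.swap.tendsto_gain_succ heq.swap le_rfl hX)
  simp only [dotProduct_smul, Pi.smul_apply, smul_eq_mul,
    mul_le_mul_iff_right₀ h.stepsize_pos, dotProduct_neg_transpose_mulVec, hvalue] at hrow hcol
  exact ⟨hx, hy, hrow, hcol⟩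

theorem exists_tendsto (h : IsPlay A η X Xh Y Yh) :
    ∃ v x y, IsEquilibrium A v x y ∧ Tendsto X atTop (𝓝 x) ∧ Tendsto Y atTop (𝓝 y) := by
  have : Nonempty (Fin n) := nonempty_of_mem_stdSimplex (h.left.mem 0).1
  have : Nonempty (Fin m) := nonempty_of_mem_stdSimplex (h.right.mem 0).1
  obtain ⟨v, xs, ys, heq⟩ := exists_isEquilibrium A
  have hl : (hyperfilter ℕ : Filter ℕ) ≤ atTop := Nat.hyperfilter_le_atTop
  obtain ⟨x, hx, hX⟩ := (isCompact_stdSimplex ℝ (Fin n)).ultrafilter_le_nhds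
    ((hyperfilter ℕ).map X) (tendsto_principal.2 (.of_forall fun t => (h.left.mem t).1))
  obtain ⟨y, hy, hY⟩ := (isCompact_stdSimplex ℝ (Fin m)).ultrafilter_le_nhds
    ((hyperfilter ℕ).map Y) (tendsto_principal.2 (.of_forall fun t => (h.right.mem t).1))
  have hX' := h.tendsto_left heq hl hx hy hX hY
  have hY' := h.swap.tendsto_left heq.swap hl hy hx hY hX
  exact ⟨v, x, y, h.isEquilibrium_of_tendsto heq hx hy hX' hY', hX', hY'⟩

end IsPlay

end ClusterPoint

section Iterate

variable {n m : ℕ} (A : Matrix (Fin n) (Fin m) ℝ) {η : ℝ} {z0 z1 : (Fin n → ℝ) × (Fin m → ℝ)}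

theorem iterate_mem (η : ℝ) (h0 : z0 ∈ simplexInterior n ×ˢ simplexInterior m)
    (h1 : z1 ∈ simplexInterior n ×ˢ simplexInterior m) :
    ∀ t, iterate A η z0 z1 t ∈ simplexInterior n ×ˢ simplexInterior m
  | 0 => h0
  | 1 => h1
  | t + 2 =>
    have ih := iterate_mem η h0 h1 (t + 1)
    ⟨reweight_mem_simplexInterior ih.1 _, reweight_mem_simplexInterior ih.2 _⟩

theorem exists_isPlay_iterate (hη : 0 < η) (hA : 8 * (η * entryNorm A) ≤ 1)
    (h0 : z0 ∈ simplexInterior n ×ˢ simplexInterior m)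
    (h1 : z1 ∈ simplexInterior n ×ˢ simplexInterior m) :
    ∃ Xh Yh, IsPlay A η (fun t => (iterate A η z0 z1 t).1) Xh
      (fun t => (iterate A η z0 z1 t).2) Yh := by
  have hmem := iterate_mem A η h0 h1
  refine ⟨_, _, isOptimisticHedge_of_succ_succ (fun t => (hmem t).1) fun t => ?_,
    isOptimisticHedge_of_succ_succ (fun t => (hmem t).2) fun t => ?_, hη, hA⟩
  · simp only [iterate, step]
    congr 1
    funext i
    simp only [Pi.sub_apply, Pi.smul_apply, smul_eq_mul]
    ring
  · simp only [iterate, step, neg_mulVec]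
    congr 1
    funext j
    simp only [Pi.sub_apply, Pi.smul_apply, Pi.neg_apply, smul_eq_mul]
    ring

theorem uniform_mem_simplexInterior (k : ℕ) [Nonempty (Fin k)] :
    uniform k ∈ simplexInterior k := by
  have hk : (0 : ℝ) < k := Nat.cast_pos.2 (Fin.pos_iff_nonempty.2 ‹_›)
  have hpos : ∀ i, 0 < uniform k i := fun _ => one_div_pos.2 hk
  refine ⟨⟨fun i => (hpos i).le, ?_⟩, hpos⟩
  simp [uniform, hk.ne']

theorem IsOptimal.uniform_mem {A : Matrix (Fin n) (Fin m) ℝ} {x : Fin n → ℝ} {y : Fin m → ℝ}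
    (h : IsOptimal A x y) : (uniform n, uniform m) ∈ simplexInterior n ×ˢ simplexInterior m :=
  have := nonempty_of_mem_stdSimplex h.left_mem
  have := nonempty_of_mem_stdSimplex h.right_mem
  ⟨uniform_mem_simplexInterior n, uniform_mem_simplexInterior m⟩

end Iterate

end OMWU

theorem theorem2_general {n m : ℕ} (A : Matrix (Fin n) (Fin m) ℝ) :
    ∃ η₀ : ℝ, 0 < η₀ ∧ ∀ η : ℝ, 0 < η → η < η₀ →
      ∀ z0 ∈ OMWU.simplexInterior n ×ˢ OMWU.simplexInterior m,
      ∀ z1 ∈ OMWU.simplexInterior n ×ˢ OMWU.simplexInterior m,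
      ∃ z, OMWU.IsOptimal A z.1 z.2 ∧ Tendsto (OMWU.iterate A η z0 z1) atTop (𝓝 z) := by
  have hA := OMWU.entryNorm_nonneg A
  refine ⟨1 / (8 * (OMWU.entryNorm A + 1)), by positivity, fun η hη hη₀ z0 h0 z1 h1 => ?_⟩
  rw [lt_div_iff₀ (by positivity)] at hη₀
  obtain ⟨Xh, Yh, h⟩ := OMWU.exists_isPlay_iterate A hη (by linarith) h0 h1
  obtain ⟨v, x, y, heq, hX, hY⟩ := h.exists_tendsto
  exact ⟨(x, y), heq.isOptimal, hX.prodMk_nhds hY⟩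

theorem theorem2 {n m : ℕ} (A : Matrix (Fin n) (Fin m) ℝ)
    (xs : Fin n → ℝ) (ys : Fin m → ℝ)
    (hopt : OMWU.IsOptimal A xs ys)
    (huniq : ∀ x y, OMWU.IsOptimal A x y → x = xs ∧ y = ys) :
    (∃ η₀ : ℝ, 0 < η₀ ∧ ∀ η : ℝ, 0 < η → η < η₀ →
      Tendsto
        (OMWU.iterate A η (OMWU.uniform n, OMWU.uniform m) (OMWU.uniform n, OMWU.uniform m))
        atTop (𝓝 (xs, ys))) ∧
    (∀ x0 ∈ OMWU.simplexInterior n, ∀ x1 ∈ OMWU.simplexInterior n,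
      ∀ y0 ∈ OMWU.simplexInterior m, ∀ y1 ∈ OMWU.simplexInterior m,
      ∃ η₀ : ℝ, 0 < η₀ ∧ ∀ η : ℝ, 0 < η → η < η₀ →
        Tendsto (OMWU.iterate A η (x0, y0) (x1, y1)) atTop (𝓝 (xs, ys))) := by
  obtain ⟨η₀, hη₀, h⟩ := theorem2_general A
  have hlim : ∀ η, 0 < η → η < η₀ → ∀ z0 ∈ OMWU.simplexInterior n ×ˢ OMWU.simplexInterior m,
      ∀ z1 ∈ OMWU.simplexInterior n ×ˢ OMWU.simplexInterior m,
      Tendsto (OMWU.iterate A η z0 z1) atTop (𝓝 (xs, ys)) := fun η hη hlt z0 h0 z1 h1 => by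
    obtain ⟨⟨x, y⟩, hxy, hlim⟩ := h η hη hlt z0 h0 z1 h1
    obtain ⟨rfl, rfl⟩ := huniq x y hxy
    exact hlim
  exact ⟨⟨η₀, hη₀, fun η hη hlt => hlim η hη hlt _ hopt.uniform_mem _ hopt.uniform_mem⟩,
    fun x0 hx0 x1 hx1 y0 hy0 y1 hy1 =>
      ⟨η₀, hη₀, fun η hη hlt => hlim η hη hlt _ ⟨hx0, hy0⟩ _ ⟨hx1, hy1⟩⟩⟩
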